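/- Let $T,N\ge 1$, $K\ge 0$ and $C>0$. Prospects are elements $X=(X_{t,n})$ of $\mathbb R^{TN}$, where $X_{t,n}$ is the value of attribute $n\in\{1,\dots,N\}$ in scenario $t\in\{1,\dots,T\}$; write $X_n=(X_{t,n})_{t}\in\mathbb R^T$. The $T$ scenarios are equally likely, and $\|X\|_\infty=\max_{t,n}|X_{t,n}|$. Let $W_0$ and $(W_k,Y_k)_{k=1}^K$ be prospects, and let $\Theta$ be the family $W_0,W_1,Y_1,\dots,W_K,Y_K$ of $J=2K+1$ prospects. Let $\mathscr R_L$ be the set of all functions $\phi$ on $\mathbb R^{TN}$ that are upper semicontinuous, nondecreasing for the componentwise order, quasi-concave, law invariant ($\phi(X)=\phi(Y)$ whenever $X$ and $Y$ have the same distribution on $\mathbb R^N$), $C$-Lipschitz for $\|\cdot\|_\infty$, normalized by $\phi(W_0)=0$, and satisfy $\phi(W_k)\ge\phi(Y_k)$ for all $k$. Let $\psi(X)=\inf_{\phi\in\mathscr R_L}\phi(X)$ be the law invariant robust choice function, and $\mathcal A_{L,v}=\{X\in\mathbb R^{TN}:\psi(X)\ge v\}$. For a permutation $\sigma$ of $\{1,\dots,T\}$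 let $\sigma(X)_{t,n}=X_{\sigma(t),n}$, and let $\Theta_L$ be the set of all $\sigma(\theta)$ with $\theta\in\Theta$. The value problem is to minimize $\sum_{\theta\in\Theta_L}v_\theta$ over $v_\theta\in\mathbb R$, $s_\theta\in\mathbb R^{TN}$ ($\theta\in\Theta_L$) subject to $v_\theta+\max\{\langle s_\theta,\theta'-\theta\rangle,0\}\ge v_{\theta'}$ for all $\theta\ne\theta'$ in $\Theta_L$; $s_\theta\ge0$ and $\|s_\theta\|_1\le C$ for all $\theta\in\Theta_L$; $v_{\sigma(W_k)}\ge v_{\sigma'(Y_k)}$ for all $k,\sigma,\sigma'$; and $v_{\sigma(W_0)}=0$ for all $\sigma$. **Theorem.** The value problem has an optimal solution, and every optimal solution has the values $v^*_\theta=\psi(\theta)$ for $\theta\in\Theta$. Let $\theta_1,\dots,\theta_J$ be any ordering of the family $\Theta$ with $v^*_{\theta_1}\ge\dots\ge v^*_{\theta_J}$ (one exists), and put $v^*_{\theta_{J+1}}=-\infty$. Then for every real $v\le0$ there is exactly one index $\kappa=\kappa(v)$ with $v^*_{\theta_{\kappa+1}}<v\le v^*_{\theta_\kappa}$; it satisfies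 $1\le\kappa\le J$, and $\mathcal A_{L,v}$ is the set of all $X\in\mathbb R^{TN}$ for which there exist $p\in\mathbb R^{\kappa}$, $q\in\mathbb R$ and $\rho_1,\dots,\rho_\kappa\in\mathbb R^{T\times T}$ with $$\sum_{i=1}^{\kappa}v^*_{\theta_i}p_i-Cq\ge v,\qquad \sum_{i=1}^{\kappa}\rho_i^{\top}\theta_{i,n}-X_n\le q\,\mathbf 1_T\quad(n=1,\dots,N),$$ $$\sum_{i=1}^{\kappa}p_i=1,\qquad p\ge0,\qquad q\ge0,$$ $$\mathbf 1_T^\top\rho_i=p_i\mathbf 1_T^\top,\qquad \rho_i\mathbf 1_T=p_i\mathbf 1_T,\qquad \rho_i\ge0\ \text{entrywise}\quad(i=1,\dots,\kappa),$$ where $\theta_{i,n}\in\mathbb R^T$ is attribute $n$ of $\theta_i$. This system has polynomial size: besides $X$ it has $\kappa(T^2+1)+1$ real variables, and it can be written as $TN+\kappa(T^2+4T+1)+4$ linear inequalities (each equation counted as two), where $\kappa\le 2K+1$. -/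

import Mathlib

open MeasureTheory ProbabilityTheory
open scoped Matrix

noncomputable section

namespace RobustChoice

/-- Prospects on the sample space `Fin T` with `N` attributes: `X t n` is attribute `n` in
scenario `t`.  The order is componentwise, and the norm is the maximum of all `|X t n|`. -/
abbrev Prospect (T N : ℕ) : Type := Fin T → Fin N → ℝ

/-- The normalizing prospect together with the elicited comparisons: the decision maker weakly
prefers `W k` to `Y k`, for every `k`. -/
structure ElicitationData (T N K : ℕ) where
  W₀ : Prospect T N
  W : Fin K → Prospect T N
  Y : Fin K → Prospect T N

/-- The index set of the family `W₀, W₁, Y₁, …, W_K, Y_K`. -/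
abbrev ProspectIndex (K : ℕ) : Type := Option (Fin K ⊕ Fin K)

variable {T N K : ℕ}

/-- The family `Θ` of the `2 K + 1` prospects `W₀, W₁, Y₁, …, W_K, Y_K`. -/
def ElicitationData.prospect (E : ElicitationData T N K) : ProspectIndex K → Prospect T N
  | none => E.W₀
  | some (Sum.inl k) => E.W k
  | some (Sum.inr k) => E.Y k

/-! ### Choice functions and the robust choice function -/

/-- The uniform probability measure on the scenarios. -/
def scenarioMeasure (T : ℕ) : Measure (Fin T) := uniformOn Set.univ

/-- The value of `φ` depends only on the distribution of the prospect on `ℝ^N`. -/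
def LawInvariant (φ : Prospect T N → ℝ) : Prop :=
  ∀ X Y : Prospect T N,
    IdentDistrib X Y (scenarioMeasure T) (scenarioMeasure T) → φ X = φ Y

/-- The law invariant ambiguity set: upper semicontinuous, monotone, quasi-concave, normalized,
`C`-Lipschitz, law invariant choice functions that agree with the elicited comparisons. -/
structure IsLawAdmissible (C : ℝ) (E : ElicitationData T N K) (φ : Prospect T N → ℝ) :
    Prop where
  usc : UpperSemicontinuous φ
  mon : Monotone φ
  qco : QuasiconcaveOn ℝ Set.univ φ
  nor : φ E.W₀ = 0
  lip : ∀ X Y : Prospect T N, |φ X - φ Y| ≤ C * ‖X - Y‖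
  law : LawInvariant φ
  eli : ∀ k : Fin K, φ (E.Y k) ≤ φ (E.W k)

def lawAmbiguitySet (C : ℝ) (E : ElicitationData T N K) : Set (Prospect T N → ℝ) :=
  {φ | IsLawAdmissible C E φ}

/-- The law invariant robust choice function.  By the next two facts the infimum is taken over a
non-empty set of reals that is bounded below. -/
def lawRCF (C : ℝ) (E : ElicitationData T N K) (X : Prospect T N) : ℝ :=
  sInf ((fun φ : Prospect T N → ℝ => φ X) '' lawAmbiguitySet C E)

theorem lawAmbiguitySet_nonempty {C : ℝ} (hC : 0 < C) (E : ElicitationData T N K) :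
    (lawAmbiguitySet C E).Nonempty := by
  refine ⟨fun _ => 0, ?_⟩
  exact
    { usc := upperSemicontinuous_const
      mon := monotone_const
      qco := fun r => by
        by_cases h : r ≤ (0 : ℝ)
        · simpa [h] using (convex_univ : Convex ℝ (Set.univ : Set (Prospect T N)))
        · simpa [h] using (convex_empty : Convex ℝ (∅ : Set (Prospect T N)))
      nor := rfl
      lip := fun X Y => by
        simpa using mul_nonneg hC.le (norm_nonneg (X - Y))
      law := fun _ _ _ => rfl
      eli := fun _ => le_rfl }

theorem lawAmbiguitySet_bddBelow (C : ℝ) (E : ElicitationData T N K) (X : Prospect T N) :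
    BddBelow ((fun φ : Prospect T N → ℝ => φ X) '' lawAmbiguitySet C E) := by
  refine ⟨-(C * ‖X - E.W₀‖), ?_⟩
  rintro _ ⟨φ, hφ, rfl⟩
  have h := (abs_le.mp (hφ.lip X E.W₀)).1
  have h0 := hφ.nor
  simp only
  linarith

/-- The acceptance set at level `v` of the law invariant robust choice function. -/
def lawAcceptanceSet (C : ℝ) (E : ElicitationData T N K) (v : ℝ) : Set (Prospect T N) :=
  {X | v ≤ lawRCF C E X}

/-! ### The law invariant value problem -/

/-- `σ(X)`: the prospect `X` with its scenarios permuted by `σ`. -/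
def permute (σ : Equiv.Perm (Fin T)) (X : Prospect T N) : Prospect T N := fun t => X (σ t)

def pairing (s X : Prospect T N) : ℝ := ∑ t, ∑ n, s t n * X t n

def oneNorm (s : Prospect T N) : ℝ := ∑ t, ∑ n, |s t n|

open Classical in
/-- The augmented support set of all permutations of the prospects in `Θ`. -/
def lawSupport (E : ElicitationData T N K) : Finset (Prospect T N) :=
  Finset.univ.image
    (fun x : Equiv.Perm (Fin T) × ProspectIndex K => permute x.1 (E.prospect x.2))

/-- The constraints of the value problem.  Only the restrictions of `v` and `s` to the augmented
support set matter. -/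
structure IsValueFeasible (C : ℝ) (E : ElicitationData T N K)
    (v : Prospect T N → ℝ) (s : Prospect T N → Prospect T N) : Prop where
  majorant : ∀ θ ∈ lawSupport E, ∀ θ' ∈ lawSupport E, θ ≠ θ' →
    v θ' ≤ v θ + max (pairing (s θ) (θ' - θ)) 0
  subgradient_nonneg : ∀ θ ∈ lawSupport E, 0 ≤ s θ
  subgradient_norm : ∀ θ ∈ lawSupport E, oneNorm (s θ) ≤ C
  elicited : ∀ (k : Fin K) (σ σ' : Equiv.Perm (Fin T)),
    v (permute σ' (E.Y k)) ≤ v (permute σ (E.W k))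
  normalized : ∀ σ : Equiv.Perm (Fin T), v (permute σ E.W₀) = 0

/-- `(v, s)` minimizes the sum of the values over the augmented support set. -/
def IsValueOptimal (C : ℝ) (E : ElicitationData T N K)
    (v : Prospect T N → ℝ) (s : Prospect T N → Prospect T N) : Prop :=
  IsValueFeasible C E v s ∧
    ∀ (v' : Prospect T N → ℝ) (s' : Prospect T N → Prospect T N),
      IsValueFeasible C E v' s' → ∑ θ ∈ lawSupport E, v θ ≤ ∑ θ ∈ lawSupport E, v' θ

/-! ### Decompositions and level selection -/

/-- An ordering of the family `Θ` (as a list of length `J = 2 K + 1`) along which the values `v`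
do not increase. -/
def IsDecomposition (E : ElicitationData T N K) (v : Prospect T N → ℝ)
    (d : Fin (2 * K + 1) ≃ ProspectIndex K) : Prop :=
  Antitone fun i => v (E.prospect (d i))

/-- For a list `w` of length `J`, the `j`-th value counted from `1`, with the value `-∞` after
the end of the list. -/
def extendedValue {J : ℕ} (w : Fin J → ℝ) (j : ℕ) : EReal :=
  if h : 1 ≤ j ∧ j ≤ J then ((w ⟨j - 1, by omega⟩ : ℝ) : EReal) else ⊥

/-- The set of indices `j ∈ [J + 1]` with `w_{j+1} < v ≤ w_j`, where `w_{J+1} = -∞`. -/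
def levelSelection {J : ℕ} (w : Fin J → ℝ) (v : ℝ) : Set ℕ :=
  {j | 1 ≤ j ∧ j ≤ J + 1 ∧ extendedValue w (j + 1) < (v : EReal) ∧
    (v : EReal) ≤ extendedValue w j}

/-! ### The polyhedral description -/

/-- The linear system, in the prospect `X` and the auxiliary variables `p`, `q`, `ρ`, built from
the prospects `θ 0, …, θ (k - 1)` with values `w 0, …, w (k - 1)`. -/
structure LawAcceptanceSystem (C v : ℝ) {k : ℕ} (θ : Fin k → Prospect T N) (w : Fin k → ℝ)
    (X : Prospect T N) (p : Fin k → ℝ) (q : ℝ) (ρ : Fin k → Matrix (Fin T) (Fin T) ℝ) :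
    Prop where
  level : v ≤ ∑ i, w i * p i - C * q
  domination : ∀ n : Fin N, ∀ t : Fin T,
    ∑ i, ((ρ i)ᵀ *ᵥ fun u => θ i u n) t - X t n ≤ q
  sum_p : ∑ i, p i = 1
  p_nonneg : ∀ i, 0 ≤ p i
  q_nonneg : 0 ≤ q
  column_sum : ∀ i, ∀ t : Fin T, ∑ u, ρ i u t = p i
  row_sum : ∀ i, ∀ t : Fin T, ∑ u, ρ i t u = p i
  ρ_nonneg : ∀ i, ∀ t u : Fin T, 0 ≤ ρ i t u

end RobustChoice

end

noncomputable section

namespace RobustChoice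

variable {T N K : ℕ}

/-! ### Law invariance is invariance under permutations of the scenarios -/

/-! Write `ψ` for `lawRCF`. Every defining property of an admissible function survives a pointwise
infimum, so `ψ` is itself admissible, hence the least admissible function.

Value problem: by separation `ψ` has a kinked majorant at each point (`IsRegular.exists_kink`), so
its values are feasible. Conversely, the minimum of the kinks of a feasible solution interpolates
its values on the support, and symmetrizing that minimum gives an admissible function, whence `ψ ≤
v` there (`IsValueFeasible.lawRCF_le`). So `ψ` is optimal, and every optimum agrees with it
termwise.

Acceptance set: it is the upward closure of the convex hull of the points `σ(θ_i) - ((w_i - v) / C)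
• 1` with `w_i = ψ(θ_i) ≥ v`. These points are accepted by the Lipschitz bound. For `X` outside the
closure, a separating functional gives a kink at `X` of level below `v` which, after symmetrization,
cuts `ψ` down at `X` without changing it on `Θ` (`exists_lawAcceptanceSystem`, `lawRCF_le_of_kink`).
Birkhoff's theorem replaces the `T!` permutation weights by scaled doubly stochastic matrices, which
makes the system polynomial. -/

lemma scenarioMeasure_apply (s : Set (Fin T)) :
    scenarioMeasure T s = (Nat.card s : ENNReal) / (T : ENNReal) := by
  classical
  rw [scenarioMeasure, uniformOn_univ, Measure.count_apply_finite s s.toFinite, Fintype.card_fin,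
    Nat.card_eq_card_finite_toFinset s.toFinite]

lemma identDistrib_permute (σ : Equiv.Perm (Fin T)) (X : Prospect T N) :
    IdentDistrib (permute σ X) X (scenarioMeasure T) (scenarioMeasure T) where
  aemeasurable_fst := Measurable.of_discrete.aemeasurable
  aemeasurable_snd := Measurable.of_discrete.aemeasurable
  map_eq := by
    ext s hs
    rw [Measure.map_apply Measurable.of_discrete hs, Measure.map_apply Measurable.of_discrete hs,
      scenarioMeasure_apply, scenarioMeasure_apply]
    congr 2
    exact Nat.card_congr (σ.subtypeEquiv fun _ => Iff.rfl)

/-- Under the uniform measure, equal laws mean that the fibres of `X` and `Y` over each value have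
the same cardinality; bijections between the fibres glue to a permutation. -/
lemma exists_permute_eq (hT : 1 ≤ T) {X Y : Prospect T N}
    (h : IdentDistrib X Y (scenarioMeasure T) (scenarioMeasure T)) :
    ∃ σ : Equiv.Perm (Fin T), permute σ Y = X := by
  have key : ∀ y : Fin N → ℝ, Nonempty ({t // X t = y} ≃ {t // Y t = y}) := by
    intro y
    have h1 := congrArg (fun μ => μ {y}) h.map_eq
    rw [Measure.map_apply Measurable.of_discrete (measurableSet_singleton y),
      Measure.map_apply Measurable.of_discrete (measurableSet_singleton y),
      scenarioMeasure_apply, scenarioMeasure_apply] at h1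
    have hT0 : (T : ENNReal) ≠ 0 := by
      exact_mod_cast (by omega : T ≠ 0)
    have h2 := congrArg (· * (T : ENNReal)) h1
    simp only [ENNReal.div_mul_cancel hT0 (ENNReal.natCast_ne_top T)] at h2
    have h3 : Nat.card (X ⁻¹' {y}) = Nat.card (Y ⁻¹' {y}) := by exact_mod_cast h2
    exact Finite.card_eq.1 h3
  have e := fun y => (key y).some
  refine ⟨(Equiv.sigmaFiberEquiv X).symm.trans
    ((Equiv.sigmaCongrRight e).trans (Equiv.sigmaFiberEquiv Y)), ?_⟩
  funext t
  exact (e (X t) ⟨t, rfl⟩).2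

lemma lawInvariant_iff (hT : 1 ≤ T) {φ : Prospect T N → ℝ} :
    LawInvariant φ ↔ ∀ (σ : Equiv.Perm (Fin T)) (X : Prospect T N), φ (permute σ X) = φ X := by
  refine ⟨fun h σ X => h _ _ (identDistrib_permute σ X), fun h X Y hXY => ?_⟩
  obtain ⟨σ, rfl⟩ := exists_permute_eq hT hXY
  exact h σ Y

/-! ### The pairing and the norms -/

lemma pairing_add (s X Y : Prospect T N) : pairing s (X + Y) = pairing s X + pairing s Y := by
  simp [pairing, mul_add, Finset.sum_add_distrib]

lemma pairing_smul (s : Prospect T N) (a : ℝ) (X : Prospect T N) :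
    pairing s (a • X) = a * pairing s X := by
  simp [pairing, Finset.mul_sum, mul_left_comm]

lemma pairing_sub (s X Y : Prospect T N) : pairing s (X - Y) = pairing s X - pairing s Y := by
  simp [pairing, mul_sub, Finset.sum_sub_distrib]

lemma pairing_smul_left (s : Prospect T N) (a : ℝ) (X : Prospect T N) :
    pairing (a • s) X = a * pairing s X := by
  simp [pairing, Finset.mul_sum, mul_assoc]

lemma pairing_nonneg {s X : Prospect T N} (hs : 0 ≤ s) (hX : 0 ≤ X) : 0 ≤ pairing s X :=
  Finset.sum_nonneg fun t _ => Finset.sum_nonneg fun n _ => mul_nonneg (hs t n) (hX t n)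

lemma abs_apply_le_norm (X : Prospect T N) (t : Fin T) (n : Fin N) : |X t n| ≤ ‖X‖ :=
  (norm_le_pi_norm (X t) n).trans (norm_le_pi_norm X t)

lemma pairing_le (s X : Prospect T N) : pairing s X ≤ oneNorm s * ‖X‖ := by
  rw [pairing, oneNorm, Finset.sum_mul]
  refine Finset.sum_le_sum fun t _ => ?_
  rw [Finset.sum_mul]
  refine Finset.sum_le_sum fun n _ => (le_abs_self _).trans ?_
  rw [abs_mul]
  exact mul_le_mul_of_nonneg_left (abs_apply_le_norm X t n) (abs_nonneg _)

lemma oneNorm_eq_pairing_one {s : Prospect T N} (hs : 0 ≤ s) : oneNorm s = pairing s 1 := by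
  simp only [oneNorm, pairing, Pi.one_apply, mul_one]
  exact Finset.sum_congr rfl fun t _ => Finset.sum_congr rfl fun n _ => abs_of_nonneg (hs t n)

lemma norm_smul_one_le {m : ℝ} (hm : 0 ≤ m) : ‖(m • 1 : Prospect T N)‖ ≤ m := by
  refine (pi_norm_le_iff_of_nonneg hm).2 fun t => (pi_norm_le_iff_of_nonneg hm).2 fun n => ?_
  simp [abs_of_nonneg hm]

lemma exists_pairing_eq (f : Prospect T N →ₗ[ℝ] ℝ) : ∃ s : Prospect T N, ∀ X, f X = pairing s X := by
  refine ⟨fun t n => f (Pi.single t (Pi.single n 1)), fun X => ?_⟩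
  have hX : X = ∑ t, ∑ n, X t n • (Pi.single t (Pi.single n 1) : Prospect T N) := by
    funext t n
    simp [Finset.sum_apply, Pi.single_apply, apply_ite, ite_apply]
  conv_lhs => rw [hX]
  simp [pairing, mul_comm]

/-- A nonzero positive functional is a positive multiple of a functional of one-norm `C`. -/
lemma exists_normalized {C : ℝ} (hC : 0 < C) (f : Prospect T N →ₗ[ℝ] ℝ)
    (hf : ∀ Z, 0 ≤ Z → 0 ≤ f Z) {X : Prospect T N} (hX : f X ≠ 0) :
    ∃ (s : Prospect T N) (a : ℝ), 0 ≤ s ∧ 0 < a ∧ oneNorm s = C ∧ ∀ X, pairing s X = a * f X := by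
  obtain ⟨s, hs⟩ := exists_pairing_eq f
  have hs0 : 0 ≤ s := by
    intro t n
    have h := hf (Pi.single t (Pi.single n 1))
      (Pi.single_nonneg.2 (Pi.single_nonneg.2 zero_le_one))
    rw [hs] at h
    simpa [pairing, Pi.single_apply, apply_ite, ite_apply] using h
  have hpos : 0 < oneNorm s := by
    have h0 : 0 ≤ oneNorm s :=
      Finset.sum_nonneg fun t _ => Finset.sum_nonneg fun n _ => abs_nonneg _
    refine h0.lt_of_ne fun h => hX ?_
    have h1 := pairing_le s X
    have h2 := pairing_le s ((-1 : ℝ) • X)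
    rw [pairing_smul] at h2
    rw [← h, zero_mul] at h1 h2
    rw [hs]
    linarith
  have hCs : 0 < C / oneNorm s := div_pos hC hpos
  refine ⟨(C / oneNorm s) • s, C / oneNorm s, smul_nonneg hCs.le hs0, hCs, ?_, fun X => ?_⟩
  · rw [oneNorm_eq_pairing_one (smul_nonneg hCs.le hs0), pairing_smul_left,
      ← oneNorm_eq_pairing_one hs0]
    field_simp
  · rw [pairing_smul_left, hs]

/-! ### Monotone quasi-concave Lipschitz functions -/

/-- Monotone, quasi-concave and `C`-Lipschitz functions. -/
structure IsRegular (C : ℝ) (φ : Prospect T N → ℝ) : Prop where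
  mon : Monotone φ
  qco : QuasiconcaveOn ℝ Set.univ φ
  lip : ∀ X Y : Prospect T N, φ X ≤ φ Y + C * ‖X - Y‖

lemma IsLawAdmissible.isRegular {C : ℝ} {E : ElicitationData T N K} {φ : Prospect T N → ℝ}
    (h : IsLawAdmissible C E φ) : IsRegular C φ :=
  ⟨h.mon, h.qco, fun X Y => by linarith [(abs_le.1 (h.lip X Y)).2]⟩

namespace IsRegular

variable {C : ℝ} {φ : Prospect T N → ℝ}

lemma abs_sub_le (h : IsRegular C φ) (X Y : Prospect T N) : |φ X - φ Y| ≤ C * ‖X - Y‖ := by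
  have h1 := h.lip X Y
  have h2 := h.lip Y X
  rw [norm_sub_rev] at h2
  exact abs_le.2 ⟨by linarith, by linarith⟩

lemma continuous (h : IsRegular C φ) (hC : 0 < C) : Continuous φ :=
  (LipschitzWith.of_dist_le_mul (K := ⟨C, hC.le⟩) fun X Y => by
    rw [Real.dist_eq, dist_eq_norm]; exact h.abs_sub_le X Y).continuous

lemma isLawAdmissible (h : IsRegular C φ) (hC : 0 < C) (hT : 1 ≤ T) {E : ElicitationData T N K}
    (hnor : φ E.W₀ = 0)
    (hlaw : ∀ (σ : Equiv.Perm (Fin T)) (X : Prospect T N), φ (permute σ X) = φ X)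
    (heli : ∀ k, φ (E.Y k) ≤ φ (E.W k)) : IsLawAdmissible C E φ where
  usc := (h.continuous hC).upperSemicontinuous
  mon := h.mon
  qco := h.qco
  nor := hnor
  lip := h.abs_sub_le
  law := (lawInvariant_iff hT).2 hlaw
  eli := heli

lemma convex_le (h : IsRegular C φ) (r : ℝ) : Convex ℝ {X | r ≤ φ X} := by
  simpa using h.qco r

lemma of_convex_le (hm : Monotone φ) (hq : ∀ r : ℝ, Convex ℝ {X | r ≤ φ X})
    (hl : ∀ X Y : Prospect T N, φ X ≤ φ Y + C * ‖X - Y‖) : IsRegular C φ :=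
  ⟨hm, fun r => by simpa using hq r, hl⟩

lemma iInf {ι : Sort*} [Nonempty ι] {f : ι → Prospect T N → ℝ} (hf : ∀ i, IsRegular C (f i))
    (hb : ∀ X, BddBelow (Set.range fun i => f i X)) : IsRegular C fun X => ⨅ i, f i X := by
  refine of_convex_le (fun X Y hXY => ciInf_mono (hb X) fun i => (hf i).mon hXY) (fun r => ?_)
    fun X Y => ?_
  · have : {X | r ≤ ⨅ i, f i X} = ⋂ i, {X | r ≤ f i X} := by
      ext X
      simp [le_ciInf_iff (hb X)]
    rw [this]
    exact convex_iInter fun i => (hf i).convex_le r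
  · rw [← sub_le_iff_le_add]
    exact le_ciInf fun i => sub_le_iff_le_add.2 ((ciInf_le (hb X) i).trans ((hf i).lip X Y))

lemma inf {g : Prospect T N → ℝ} (hφ : IsRegular C φ) (hg : IsRegular C g) :
    IsRegular C fun X => min (φ X) (g X) := by
  refine of_convex_le (fun X Y hXY => min_le_min (hφ.mon hXY) (hg.mon hXY)) (fun r => ?_)
    fun X Y => ?_
  · have : {X | r ≤ min (φ X) (g X)} = {X | r ≤ φ X} ∩ {X | r ≤ g X} := by
      ext X
      simp
    rw [this]
    exact (hφ.convex_le r).inter (hg.convex_le r)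
  · rw [← min_add_add_right]
    exact min_le_min (hφ.lip X Y) (hg.lip X Y)

lemma comp_permute (h : IsRegular C φ) (σ : Equiv.Perm (Fin T)) :
    IsRegular C fun X => φ (permute σ X) := by
  refine of_convex_le (fun X Y hXY => h.mon fun t => hXY (σ t)) (fun r => ?_) fun X Y => ?_
  · intro X hX Y hY a b ha hb hab
    exact h.convex_le r hX hY ha hb hab
  · have hn : ‖permute σ X - permute σ Y‖ = ‖X - Y‖ := by
      refine le_antisymm ?_ ?_
      · exact (pi_norm_le_iff_of_nonneg (norm_nonneg _)).2 fun t => norm_le_pi_norm (X - Y) (σ t)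
      · refine (pi_norm_le_iff_of_nonneg (norm_nonneg _)).2 fun t => ?_
        simpa [permute] using norm_le_pi_norm (permute σ X - permute σ Y) (σ.symm t)
    rw [← hn]
    exact h.lip _ _

end IsRegular

/-- The kinked majorant with value `c` and gradient `s` at `θ`. -/
def kink (c : ℝ) (s θ X : Prospect T N) : ℝ := c + max (pairing s (X - θ)) 0

lemma le_kink (c : ℝ) (s θ X : Prospect T N) : c ≤ kink c s θ X :=
  le_add_of_nonneg_right (le_max_right _ _)

lemma kink_self (c : ℝ) (s θ : Prospect T N) : kink c s θ θ = c := by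
  simp [kink, pairing]

/-- A superlevel set of a kink is the whole space or a half-space, hence convex; the Lipschitz bound
is duality of the one-norm and the max-norm. -/
lemma isRegular_kink {C : ℝ} {s : Prospect T N} (hs : 0 ≤ s) (hsC : oneNorm s ≤ C) (c : ℝ)
    (θ : Prospect T N) : IsRegular C (kink c s θ) := by
  have hmon : ∀ {X Y : Prospect T N}, X ≤ Y → pairing s (X - θ) ≤ pairing s (Y - θ) := by
    intro X Y hXY
    have h := pairing_nonneg hs (sub_nonneg.2 hXY)
    simp only [pairing_sub] at h ⊢
    linarith
  refine IsRegular.of_convex_le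
    (fun X Y hXY => add_le_add le_rfl (max_le_max (hmon hXY) le_rfl)) (fun r => ?_) fun X Y => ?_
  · intro X hX Y hY a b ha hb hab
    simp only [Set.mem_ofPred_eq, kink, pairing_sub, pairing_add, pairing_smul] at hX hY ⊢
    rcases le_or_gt r c with h | h
    · exact h.trans (le_add_of_nonneg_right (le_max_right _ _))
    · have hX' : r - c ≤ pairing s X - pairing s θ := by
        rcases le_max_iff.1 (sub_le_iff_le_add'.2 hX) with h' | h' <;> linarith
      have hY' : r - c ≤ pairing s Y - pairing s θ := by
        rcases le_max_iff.1 (sub_le_iff_le_add'.2 hY) with h' | h' <;> linarith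
      have := le_max_left (a * pairing s X + b * pairing s Y - pairing s θ) 0
      have e : a * (r - c) + b * (r - c) = r - c := by rw [← add_mul, hab, one_mul]
      have e' : a * pairing s θ + b * pairing s θ = pairing s θ := by rw [← add_mul, hab, one_mul]
      have h1 := mul_le_mul_of_nonneg_left hX' ha
      have h2 := mul_le_mul_of_nonneg_left hY' hb
      linarith
  · have h1 : pairing s (X - Y) ≤ C * ‖X - Y‖ :=
      (pairing_le s _).trans (mul_le_mul_of_nonneg_right hsC (norm_nonneg _))
    have h0 : 0 ≤ C * ‖X - Y‖ := by
      refine mul_nonneg (le_trans ?_ hsC) (norm_nonneg _)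
      exact Finset.sum_nonneg fun t _ => Finset.sum_nonneg fun n _ => abs_nonneg _
    simp only [kink, pairing_sub] at h1 ⊢
    have h2 := le_max_left (pairing s Y - pairing s θ) 0
    have h3 := le_max_right (pairing s Y - pairing s θ) 0
    have : max (pairing s X - pairing s θ) 0 ≤
        max (pairing s Y - pairing s θ) 0 + C * ‖X - Y‖ := max_le (by linarith) (by linarith)
    linarith

/-- Makes separating functionals positive: a functional bounded below along a ray is nonnegative in
its direction. -/
lemma nonneg_of_forall_lt_add_mul {a b c : ℝ} (h : ∀ l : ℝ, 0 ≤ l → a < b + l * c) : 0 ≤ c := by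
  by_contra! hc
  have h0 := h 0 le_rfl
  have h1 := h ((a - b) / c) (div_nonneg_of_nonpos (by linarith) hc.le)
  rw [div_mul_cancel₀ _ hc.ne] at h1
  linarith

/-- At every point, a monotone quasi-concave `C`-Lipschitz function has a kinked majorant. -/
lemma IsRegular.exists_kink {C : ℝ} (hC : 0 < C) {φ : Prospect T N → ℝ} (h : IsRegular C φ)
    (θ : Prospect T N) :
    ∃ s : Prospect T N, 0 ≤ s ∧ oneNorm s ≤ C ∧ ∀ X, φ X ≤ kink (φ θ) s θ X := by
  by_cases hU : ∀ X, φ X ≤ φ θ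
  · exact ⟨0, le_rfl, by simpa [oneNorm] using hC.le, fun X => (hU X).trans (le_kink _ _ _ _)⟩
  push Not at hU
  obtain ⟨B, hB⟩ := hU
  -- If `θ` is not a maximizer, it is separated from the nonempty open convex set of strictly better
  -- points.
  obtain ⟨f, hf⟩ := geometric_hahn_banach_point_open (t := {X | φ θ < φ X}) (x := θ)
    (by simpa using h.qco.convex_gt (φ θ))
    (isOpen_lt continuous_const (h.continuous hC)) (by simp)
  have hpos : ∀ Z, 0 ≤ Z → 0 ≤ f Z := by
    intro Z hZ
    refine nonneg_of_forall_lt_add_mul (a := f θ) (b := f B) fun l hl => ?_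
    have := hf (B + l • Z) (hB.trans_le (h.mon (le_add_of_nonneg_right (smul_nonneg hl hZ))))
    simpa using this
  have hne : f (B - θ) ≠ 0 := by
    rw [map_sub]
    exact (sub_pos.2 (hf B hB)).ne'
  obtain ⟨s, a, hs0, ha, hsC, hs⟩ := exists_normalized hC f.toLinearMap hpos hne
  refine ⟨s, hs0, hsC.le, fun X => ?_⟩
  rcases le_or_gt (φ X) (φ θ) with hX | hX
  · exact hX.trans (le_kink _ _ _ _)
  have hm : 0 < pairing s (X - θ) := by
    rw [hs]
    refine mul_pos ha ?_
    have := hf X hX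
    simpa using this
  -- Since `oneNorm s = C`, lowering `X` by `m` in every coordinate lands on the hyperplane through
  -- `θ`, which contains no strictly better point. The Lipschitz bound then recovers `C * m =
  -- pairing s (X - θ)`.
  set m := pairing s (X - θ) / C with hm_def
  have hm0 : 0 ≤ m := (div_pos hm hC).le
  have hle : φ (X - m • 1) ≤ φ θ := by
    by_contra! hlt
    have h1 := hf _ hlt
    have h2 : pairing s (X - m • 1 - θ) = 0 := by
      rw [pairing_sub, pairing_sub, pairing_smul, ← oneNorm_eq_pairing_one hs0, hsC, hm_def,
        div_mul_cancel₀ _ hC.ne', pairing_sub]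
      ring
    rw [hs] at h2
    have h3 : f (X - m • 1 - θ) = 0 := (mul_eq_zero.1 h2).resolve_left ha.ne'
    rw [map_sub] at h3
    linarith
  have h4 := h.lip X (X - m • 1)
  rw [sub_sub_cancel] at h4
  have h5 := mul_le_mul_of_nonneg_left (norm_smul_one_le (T := T) (N := N) hm0) hC.le
  have h6 : C * m = pairing s (X - θ) := by rw [hm_def]; field_simp
  have h7 := le_max_left (pairing s (X - θ)) 0
  rw [kink]
  linarith

/-- The largest permutation invariant minorant of `φ`. -/
def symmetrize (φ : Prospect T N → ℝ) (X : Prospect T N) : ℝ :=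
  ⨅ σ : Equiv.Perm (Fin T), φ (permute σ X)

lemma symmetrize_le (φ : Prospect T N → ℝ) (σ : Equiv.Perm (Fin T)) (X : Prospect T N) :
    symmetrize φ X ≤ φ (permute σ X) :=
  ciInf_le (Set.finite_range _).bddBelow σ

lemma symmetrize_permute (φ : Prospect T N → ℝ) (τ : Equiv.Perm (Fin T)) (X : Prospect T N) :
    symmetrize φ (permute τ X) = symmetrize φ X :=
  (Equiv.mulLeft τ).iInf_congr fun _ => rfl

lemma exists_symmetrize_eq (φ : Prospect T N → ℝ) (X : Prospect T N) :
    ∃ σ : Equiv.Perm (Fin T), φ (permute σ X) = symmetrize φ X :=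
  exists_eq_ciInf_of_finite

lemma IsRegular.symmetrize {C : ℝ} {φ : Prospect T N → ℝ} (h : IsRegular C φ) :
    IsRegular C (symmetrize φ) :=
  IsRegular.iInf (fun σ => h.comp_permute σ) fun _ => (Set.finite_range _).bddBelow

variable {C : ℝ} {E : ElicitationData T N K}

/-! ### The robust choice function is the least admissible choice function -/

lemma lawRCF_eq_iInf (C : ℝ) (E : ElicitationData T N K) (X : Prospect T N) :
    lawRCF C E X = ⨅ φ : lawAmbiguitySet C E, φ.1 X :=
  sInf_image'

lemma bddBelow_range_lawAmbiguitySet (C : ℝ) (E : ElicitationData T N K) (X : Prospect T N) :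
    BddBelow (Set.range fun φ : lawAmbiguitySet C E => φ.1 X) := by
  have h := lawAmbiguitySet_bddBelow C E X
  rwa [Set.image_eq_range] at h

lemma lawRCF_le {φ : Prospect T N → ℝ} (hφ : IsLawAdmissible C E φ) (X : Prospect T N) :
    lawRCF C E X ≤ φ X :=
  csInf_le (lawAmbiguitySet_bddBelow C E X) ⟨φ, hφ, rfl⟩

lemma isLawAdmissible_lawRCF (hT : 1 ≤ T) (hC : 0 < C) (E : ElicitationData T N K) :
    IsLawAdmissible C E (lawRCF C E) := by
  have hne : Nonempty (lawAmbiguitySet C E) := (lawAmbiguitySet_nonempty hC E).to_subtype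
  have hb := bddBelow_range_lawAmbiguitySet C E
  have hreg : IsRegular C (lawRCF C E) := by
    rw [funext (lawRCF_eq_iInf C E)]
    exact IsRegular.iInf (fun φ => φ.2.isRegular) hb
  refine hreg.isLawAdmissible hC hT ?_ (fun σ X => ?_) fun k => ?_
  · rw [lawRCF_eq_iInf, iInf_congr fun φ : lawAmbiguitySet C E => φ.2.nor, ciInf_const]
  · rw [lawRCF_eq_iInf, lawRCF_eq_iInf]
    exact iInf_congr fun φ => (lawInvariant_iff hT).1 φ.2.law σ X
  · rw [lawRCF_eq_iInf, lawRCF_eq_iInf]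
    exact ciInf_mono (hb _) fun φ => φ.2.eli k

lemma lawRCF_permute (hT : 1 ≤ T) (hC : 0 < C) (E : ElicitationData T N K)
    (σ : Equiv.Perm (Fin T)) (X : Prospect T N) :
    lawRCF C E (permute σ X) = lawRCF C E X :=
  (lawInvariant_iff hT).1 (isLawAdmissible_lawRCF hT hC E).law σ X

/-! ### The value problem -/

lemma permute_mem_lawSupport (E : ElicitationData T N K) (σ : Equiv.Perm (Fin T))
    (i : ProspectIndex K) : permute σ (E.prospect i) ∈ lawSupport E := by
  classical
  exact Finset.mem_image.2 ⟨(σ, i), Finset.mem_univ _, rfl⟩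

lemma prospect_mem_lawSupport (E : ElicitationData T N K) (i : ProspectIndex K) :
    E.prospect i ∈ lawSupport E :=
  permute_mem_lawSupport E 1 i

lemma exists_isValueFeasible_lawRCF (hT : 1 ≤ T) (hC : 0 < C) (E : ElicitationData T N K) :
    ∃ s, IsValueFeasible C E (lawRCF C E) s := by
  have h := isLawAdmissible_lawRCF hT hC E
  choose s hs0 hsC hs using h.isRegular.exists_kink hC
  refine ⟨s, fun θ _ θ' _ _ => hs θ θ', fun θ _ => hs0 θ, fun θ _ => hsC θ, fun k σ σ' => ?_,
    fun σ => ?_⟩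
  · rw [lawRCF_permute hT hC, lawRCF_permute hT hC]
    exact h.eli k
  · rw [lawRCF_permute hT hC]
    exact h.nor

/-- The majorant constraints say exactly that no kink undercuts `v` at another support point, so the
minimum of the kinks interpolates `v`. -/
lemma IsValueFeasible.lawRCF_le (hT : 1 ≤ T) (hC : 0 < C) {v : Prospect T N → ℝ}
    {s : Prospect T N → Prospect T N} (h : IsValueFeasible C E v s) {θ : Prospect T N}
    (hθ : θ ∈ lawSupport E) : lawRCF C E θ ≤ v θ := by
  have : Nonempty (lawSupport E) := ⟨⟨θ, hθ⟩⟩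
  let φ : Prospect T N → ℝ := fun X => ⨅ θ : lawSupport E, kink (v θ.1) (s θ.1) θ.1 X
  have hb : ∀ X, BddBelow (Set.range fun θ : lawSupport E => kink (v θ.1) (s θ.1) θ.1 X) :=
    fun X => (Set.finite_range _).bddBelow
  have hreg : IsRegular C φ := IsRegular.iInf (fun θ => isRegular_kink
    (h.subgradient_nonneg _ θ.2) (h.subgradient_norm _ θ.2) _ _) hb
  have hval : ∀ θ ∈ lawSupport E, φ θ = v θ := by
    intro θ hθ
    refine le_antisymm ((ciInf_le (hb θ) ⟨θ, hθ⟩).trans_eq (kink_self _ _ _))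
      (le_ciInf fun θ' => ?_)
    by_cases hne : θ'.1 = θ
    · rw [hne, kink_self]
    · exact h.majorant _ θ'.2 _ hθ hne
  -- `v` need not be permutation invariant, but its normalization and comparisons hold for all
  -- permutations, in particular for those attaining the minimum in `symmetrize`.
  have hadm : IsLawAdmissible C E (symmetrize φ) := by
    refine hreg.symmetrize.isLawAdmissible hC hT ?_ (symmetrize_permute φ) fun k => ?_
    · obtain ⟨σ, hσ⟩ := exists_symmetrize_eq φ E.W₀
      rw [← hσ]
      exact (hval _ (permute_mem_lawSupport E σ none)).trans (h.normalized σ)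
    · obtain ⟨σ, hσ⟩ := exists_symmetrize_eq φ (E.W k)
      refine (symmetrize_le φ 1 (E.Y k)).trans ?_
      rw [← hσ]
      exact (hval _ (permute_mem_lawSupport E 1 (some (Sum.inr k)))).trans_le
        ((h.elicited k σ 1).trans_eq (hval _ (permute_mem_lawSupport E σ (some (Sum.inl k)))).symm)
  exact (RobustChoice.lawRCF_le hadm θ).trans ((symmetrize_le φ 1 θ).trans_eq (hval θ hθ))

lemma exists_isValueOptimal_lawRCF (hT : 1 ≤ T) (hC : 0 < C) (E : ElicitationData T N K) :
    ∃ s, IsValueOptimal C E (lawRCF C E) s := by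
  obtain ⟨s, hs⟩ := exists_isValueFeasible_lawRCF hT hC E
  exact ⟨s, hs, fun v' s' h' => Finset.sum_le_sum fun θ hθ => h'.lawRCF_le hT hC hθ⟩

lemma IsValueOptimal.eq_lawRCF (hT : 1 ≤ T) (hC : 0 < C) {v : Prospect T N → ℝ}
    {s : Prospect T N → Prospect T N} (h : IsValueOptimal C E v s) {θ : Prospect T N}
    (hθ : θ ∈ lawSupport E) : v θ = lawRCF C E θ := by
  obtain ⟨s', hs'⟩ := exists_isValueFeasible_lawRCF hT hC E
  have hle : ∀ θ ∈ lawSupport E, lawRCF C E θ ≤ v θ := fun θ hθ => h.1.lawRCF_le hT hC hθ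
  have heq := le_antisymm (Finset.sum_le_sum hle) (h.2 _ _ hs')
  exact ((Finset.sum_eq_sum_iff_of_le hle).1 heq θ hθ).symm

lemma exists_isDecomposition (E : ElicitationData T N K) (v : Prospect T N → ℝ) :
    ∃ d, IsDecomposition E v d := by
  have e : Fin (2 * K + 1) ≃ ProspectIndex K :=
    (Fintype.equivFinOfCardEq (by simp; ring)).symm
  refine ⟨(Tuple.sort fun i => -v (E.prospect (e i))).trans e, fun i j hij => ?_⟩
  have := Tuple.monotone_sort (fun i => -v (E.prospect (e i))) hij
  simpa using this

/-! ### Level selection -/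

/-- The positions with value at least `v` form an initial segment, and `k` is its length. -/
lemma exists_levelSelection_eq {J : ℕ} {w : Fin J → ℝ} (hw : Antitone w) {v : ℝ}
    (hv : ∃ j, v ≤ w j) :
    ∃ k, 1 ≤ k ∧ k ≤ J ∧ levelSelection w v = {k} ∧ ∀ j : Fin J, v ≤ w j ↔ (j : ℕ) < k := by
  classical
  obtain ⟨j₀, hj₀⟩ := hv
  have hex : ∃ k : ℕ, ∀ j : Fin J, v ≤ w j → (j : ℕ) < k := ⟨J, fun j _ => j.2⟩
  set k := Nat.find hex
  have hspec : ∀ j : Fin J, v ≤ w j → (j : ℕ) < k := Nat.find_spec hex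
  have hkJ : k ≤ J := Nat.find_min' hex fun j _ => j.2
  have hk1 : 1 ≤ k := Nat.one_le_iff_ne_zero.2 fun h => by
    have := hspec j₀ hj₀
    omega
  have hiff : ∀ j : Fin J, v ≤ w j ↔ (j : ℕ) < k := by
    refine fun j => ⟨hspec j, fun hj => ?_⟩
    have hnot := Nat.find_min hex (m := k - 1) (by omega)
    push Not at hnot
    obtain ⟨i, hi, hki⟩ := hnot
    exact hi.trans (hw (Fin.le_def.2 (by omega)))
  refine ⟨k, hk1, hkJ, ?_, hiff⟩
  -- `extendedValue` counts from `1` while `Fin J` counts from `0`, so `< k` becomes `≤ k`; past `J`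
  -- the value is `⊥`, consistent with `k ≤ J`.
  have hlt : ∀ j : ℕ, 1 ≤ j → ((v : EReal) ≤ extendedValue w j ↔ j ≤ k) := by
    intro j hj
    rw [extendedValue]
    split_ifs with h
    · rw [EReal.coe_le_coe_iff, hiff]
      simp only
      omega
    · simp only [le_bot_iff, EReal.coe_ne_bot, false_iff]
      omega
  ext j
  simp only [levelSelection, Set.mem_ofPred_eq, Set.mem_singleton_iff, ← not_le]
  constructor
  · rintro ⟨h1, -, h2, h3⟩
    rw [hlt j h1] at h3
    rw [hlt (j + 1) (by omega)] at h2
    omega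
  · rintro rfl
    exact ⟨hk1, by omega, by rw [hlt _ (by omega)]; omega, (hlt _ hk1).2 le_rfl⟩

/-! ### The acceptance sets -/

/-- By Birkhoff's theorem the point is a convex combination of permuted copies of `θ`. -/
lemma convex_mem_of_doublyStochastic {S : Set (Prospect T N)} (hS : Convex ℝ S)
    {θ : Prospect T N} (hθ : ∀ σ, permute σ θ ∈ S) {p : ℝ} (hp : 0 < p)
    {ρ : Matrix (Fin T) (Fin T) ℝ} (hρ : ∀ t u, 0 ≤ ρ t u) (hcol : ∀ t, ∑ u, ρ u t = p)
    (hrow : ∀ t, ∑ u, ρ t u = p) :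
    p⁻¹ • (fun t n => (ρᵀ *ᵥ fun u => θ u n) t : Prospect T N) ∈ S := by
  have hmem : p⁻¹ • ρ ∈ doublyStochastic ℝ (Fin T) := by
    refine mem_doublyStochastic_iff_sum.2 ⟨fun t u => ?_, fun t => ?_, fun t => ?_⟩
    · exact mul_nonneg (inv_nonneg.2 hp.le) (hρ t u)
    · simp only [Matrix.smul_apply, smul_eq_mul, ← Finset.mul_sum, hrow]
      exact inv_mul_cancel₀ hp.ne'
    · simp only [Matrix.smul_apply, smul_eq_mul, ← Finset.mul_sum, hcol]
      exact inv_mul_cancel₀ hp.ne'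
  obtain ⟨c, hc0, hc1, hc⟩ := exists_eq_sum_perm_of_mem_doublyStochastic hmem
  have heq : p⁻¹ • (fun t n => (ρᵀ *ᵥ fun u => θ u n) t : Prospect T N) =
      ∑ σ, c σ • permute σ⁻¹ θ := by
    funext t n
    -- The permutation matrix of `σ` has entry `1` at `(u, t)` when `σ u = t`; the transpose
    -- therefore permutes by `σ⁻¹`.
    have h1 : ∀ u, p⁻¹ * ρ u t = ∑ σ : Equiv.Perm (Fin T), if u = σ⁻¹ t then c σ else 0 := by
      intro u
      have := congrFun (congrFun hc u) t
      simp only [Matrix.smul_apply, smul_eq_mul, Matrix.sum_apply] at this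
      rw [← this]
      refine Finset.sum_congr rfl fun σ _ => ?_
      simp [Equiv.Perm.permMatrix, PEquiv.toMatrix_apply, Equiv.eq_symm_apply, eq_comm]
    simp only [Pi.smul_apply, smul_eq_mul, Matrix.mulVec, dotProduct, Matrix.transpose_apply,
      Finset.mul_sum, ← mul_assoc, h1, Finset.sum_apply, permute, Finset.sum_mul]
    rw [Finset.sum_comm]
    simp
  rw [heq]
  exact hS.sum_mem (fun σ _ => hc0 σ) hc1 fun σ _ => hθ _

/-- Shifting a prospect down uniformly by `m` costs at most `C m`. -/
lemma IsRegular.sub_le_shift {φ : Prospect T N → ℝ} (h : IsRegular C φ) (hC : 0 < C)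
    (X : Prospect T N) {m : ℝ} (hm : 0 ≤ m) : φ X - C * m ≤ φ (X - m • 1) := by
  have h1 := h.lip X (X - m • 1)
  rw [sub_sub_cancel] at h1
  have h2 := mul_le_mul_of_nonneg_left (norm_smul_one_le (T := T) (N := N) hm) hC.le
  linarith

lemma LawAcceptanceSystem.le_lawRCF (hT : 1 ≤ T) (hC : 0 < C) {v : ℝ} {k : ℕ}
    {θ : Fin k → Prospect T N} (hv : ∀ i, v ≤ lawRCF C E (θ i)) {X : Prospect T N}
    {p : Fin k → ℝ} {q : ℝ} {ρ : Fin k → Matrix (Fin T) (Fin T) ℝ}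
    (h : LawAcceptanceSystem C v θ (fun i => lawRCF C E (θ i)) X p q ρ) :
    v ≤ lawRCF C E X := by
  have hreg := (isLawAdmissible_lawRCF hT hC E).isRegular
  set w := fun i => lawRCF C E (θ i)
  set R : Fin k → Prospect T N := fun i t n => ((ρ i)ᵀ *ᵥ fun u => θ i u n) t with hR
  -- The block of `i` is `p i` times a point of value at least `w i`; lowering that point by `(w i -
  -- v) / C` keeps its value at least `v`. If `p i = 0`, the row sums force `ρ i = 0` and any
  -- accepted point serves.
  have hz : ∀ i, ∃ z : Prospect T N, v ≤ lawRCF C E z ∧ p i • z = R i - (p i * ((w i - v) / C)) • 1 := by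
    intro i
    have hm : 0 ≤ (w i - v) / C := div_nonneg (sub_nonneg.2 (hv i)) hC.le
    have hCm : C * ((w i - v) / C) = w i - v := by field_simp
    rcases (h.p_nonneg i).eq_or_lt with h0 | hpos
    · refine ⟨θ i, hv i, ?_⟩
      have hρ0 : ∀ u t, ρ i u t = 0 := fun u t =>
        (Finset.sum_eq_zero_iff_of_nonneg fun t _ => h.ρ_nonneg i u t).1
          ((h.row_sum i u).trans h0.symm) t (Finset.mem_univ _)
      have hR0 : R i = 0 := by
        funext t n
        simp [hR, Matrix.mulVec, dotProduct, hρ0]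
      simp [← h0, hR0]
    · refine ⟨(p i)⁻¹ • R i - ((w i - v) / C) • 1, ?_, ?_⟩
      · have h1 : w i ≤ lawRCF C E ((p i)⁻¹ • R i) :=
          convex_mem_of_doublyStochastic (hreg.convex_le (w i))
            (fun σ => (lawRCF_permute hT hC E σ (θ i)).ge) hpos (h.ρ_nonneg i) (h.column_sum i)
            (h.row_sum i)
        have h2 := hreg.sub_le_shift hC ((p i)⁻¹ • R i) hm
        linarith
      · rw [smul_sub, smul_smul, smul_smul, mul_inv_cancel₀ hpos.ne', one_smul]
  choose z hz hpz using hz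
  have hmem : ∑ i, p i • z i ∈ {X | v ≤ lawRCF C E X} :=
    (hreg.convex_le v).sum_mem (fun i _ => h.p_nonneg i) h.sum_p fun i _ => hz i
  refine le_trans hmem (hreg.mon fun t n => ?_)
  have h1 := h.domination n t
  have h2 : ∑ i, p i * ((w i - v) / C) = (∑ i, w i * p i - v) / C := by
    have : ∑ i, p i * v = v := by rw [← Finset.sum_mul, h.sum_p, one_mul]
    conv_rhs => rw [← this]
    rw [← Finset.sum_sub_distrib, Finset.sum_div]
    exact Finset.sum_congr rfl fun i _ => by ring
  -- The level constraint bounds `q` by the average shift, so `X` dominates the convex combination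
  -- of the `z i`.
  have h3 : q ≤ (∑ i, w i * p i - v) / C := by
    rw [le_div_iff₀ hC]
    linarith [h.level]
  simp only [hpz, Finset.sum_sub_distrib, ← Finset.sum_smul, h2]
  simp only [Pi.sub_apply, Finset.sum_apply, Pi.smul_apply, Pi.one_apply, smul_eq_mul, mul_one, hR]
  linarith

lemma exists_lawAcceptanceSystem_of_le {v : ℝ} (hC : 0 < C) {k : ℕ} {θ : Fin k → Prospect T N}
    {w : Fin k → ℝ} (hw : ∀ i, v ≤ w i) {X : Prospect T N} {c : Fin k × Equiv.Perm (Fin T) → ℝ}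
    (hc : c ∈ stdSimplex ℝ (Fin k × Equiv.Perm (Fin T)))
    (hX : ∑ x, c x • (permute x.2 (θ x.1) - ((w x.1 - v) / C) • 1) ≤ X) :
    ∃ p q ρ, LawAcceptanceSystem C v θ w X p q ρ := by
  have hp0 : ∀ i, 0 ≤ ∑ σ, c (i, σ) := fun i => Finset.sum_nonneg fun σ _ => hc.1 _
  have hp1 : ∑ i, ∑ σ, c (i, σ) = 1 := by
    rw [← Fintype.sum_prod_type']
    exact hc.2
  have hsum : ∑ i, (w i - v) / C * ∑ σ, c (i, σ) = (∑ i, w i * ∑ σ, c (i, σ) - v) / C := by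
    have : ∑ i, v * ∑ σ, c (i, σ) = v := by rw [← Finset.mul_sum, hp1, mul_one]
    conv_rhs => rw [← this]
    rw [← Finset.sum_sub_distrib, Finset.sum_div]
    exact Finset.sum_congr rfl fun i _ => by ring
  -- `p` is the marginal of the weights, `q` the average shift, which makes the level constraint an
  -- equality, and `ρ i` the weighted sum of the permutation matrices whose transposes act as
  -- `permute σ`.
  refine ⟨fun i => ∑ σ, c (i, σ), (∑ i, w i * ∑ σ, c (i, σ) - v) / C,
    fun i => Matrix.of fun u t => ∑ σ : Equiv.Perm (Fin T), if u = σ t then c (i, σ) else 0,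
    ?_, fun n t => ?_, hp1, hp0, ?_, fun i t => ?_, fun i t => ?_, fun i t u => ?_⟩
  · rw [mul_div_cancel₀ _ hC.ne']
    linarith
  · have h := hX t n
    rw [Fintype.sum_prod_type] at h
    simp only [Finset.sum_apply, Pi.smul_apply, Pi.sub_apply, Pi.one_apply, smul_eq_mul, mul_one,
      mul_sub, Finset.sum_sub_distrib, permute, ← Finset.sum_mul] at h
    have h1 : ∀ i, ((Matrix.of fun u t => ∑ σ : Equiv.Perm (Fin T),
        if u = σ t then c (i, σ) else 0)ᵀ *ᵥ fun u => θ i u n) t =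
        ∑ σ : Equiv.Perm (Fin T), c (i, σ) * θ i (σ t) n := by
      intro i
      simp only [Matrix.mulVec, dotProduct, Matrix.transpose_apply, Matrix.of_apply,
        Finset.sum_mul]
      rw [Finset.sum_comm]
      simp
    simp only [h1, ← hsum]
    simp only [mul_comm _ (∑ σ, c (_, σ))]
    linarith
  · rw [← hsum]
    exact Finset.sum_nonneg fun i _ =>
      mul_nonneg (div_nonneg (sub_nonneg.2 (hw i)) hC.le) (hp0 i)
  · simp only [Matrix.of_apply]
    rw [Finset.sum_comm]
    simp
  · simp only [Matrix.of_apply]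
    rw [Finset.sum_comm]
    refine Finset.sum_congr rfl fun σ _ => ?_
    simp [← Equiv.symm_apply_eq σ]
  · exact Finset.sum_nonneg fun σ _ => by split_ifs; exacts [hc.1 _, le_rfl]

/-- A kink at `X` of level below `v` that keeps the values of all the prospects in `Θ` shows that
the robust choice function is less than `v` at `X`. -/
lemma lawRCF_le_of_kink (hT : 1 ≤ T) (hC : 0 < C) {s : Prospect T N} (hs : 0 ≤ s)
    (hsC : oneNorm s ≤ C) {r : ℝ} {X : Prospect T N}
    (h : ∀ i σ, lawRCF C E (E.prospect i) ≤ kink r s X (permute σ (E.prospect i))) :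
    lawRCF C E X ≤ r := by
  have hψ := isLawAdmissible_lawRCF hT hC E
  have hval : ∀ i, min (lawRCF C E (E.prospect i)) (symmetrize (kink r s X) (E.prospect i)) =
      lawRCF C E (E.prospect i) := fun i => min_eq_left (le_ciInf fun σ => h i σ)
  have hadm : IsLawAdmissible C E
      fun Z => min (lawRCF C E Z) (symmetrize (kink r s X) Z) := by
    refine (hψ.isRegular.inf (isRegular_kink hs hsC r X).symmetrize).isLawAdmissible hC hT
      ((hval none).trans hψ.nor) (fun σ Z => ?_) fun k => ?_
    · rw [lawRCF_permute hT hC, symmetrize_permute]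
    · exact ((hval (some (Sum.inr k))).trans_le (hψ.eli k)).trans_eq (hval (some (Sum.inl k))).symm
  refine (lawRCF_le hadm X).trans ((min_le_right _ _).trans ((symmetrize_le _ 1 X).trans_eq ?_))
  exact kink_self r s X

/-- If no point of the polytope lies below `X`, separating it from the lower orthant at `X` yields a
kink contradicting `v ≤ ψ(X)`. -/
lemma exists_lawAcceptanceSystem (hT : 1 ≤ T) (hC : 0 < C) {v : ℝ} {k : ℕ} (hk : 1 ≤ k)
    {d : Fin k → ProspectIndex K} (hv : ∀ i, v ≤ lawRCF C E (E.prospect (d i)))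
    (hd : ∀ j, v ≤ lawRCF C E (E.prospect j) → ∃ i, d i = j)
    {X : Prospect T N} (hX : v ≤ lawRCF C E X) :
    ∃ p q ρ, LawAcceptanceSystem C v (fun i => E.prospect (d i))
      (fun i => lawRCF C E (E.prospect (d i))) X p q ρ := by
  set w := fun i => lawRCF C E (E.prospect (d i)) with hw
  set P : Fin k × Equiv.Perm (Fin T) → Prospect T N :=
    fun x => permute x.2 (E.prospect (d x.1)) - ((w x.1 - v) / C) • 1 with hP
  by_cases hex : ∃ c ∈ stdSimplex ℝ (Fin k × Equiv.Perm (Fin T)), ∑ x, c x • P x ≤ X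
  · obtain ⟨c, hc, hcX⟩ := hex
    exact exists_lawAcceptanceSystem_of_le hC hv hc hcX
  exfalso
  push Not at hex
  have hdisj : Disjoint (Set.Iic X)
      (Fintype.linearCombination ℝ P '' stdSimplex ℝ (Fin k × Equiv.Perm (Fin T))) := by
    rw [Set.disjoint_left]
    rintro _ hle ⟨c, hc, rfl⟩
    rw [Fintype.linearCombination_apply] at hle
    exact hex c hc hle
  obtain ⟨f, a, b, hfa, hab, hfb⟩ := geometric_hahn_banach_closed_compact (convex_Iic X)
    isClosed_Iic ((convex_stdSimplex ℝ _).linear_image _)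
    ((isCompact_stdSimplex ℝ _).image (LinearMap.continuous_of_finiteDimensional _)) hdisj
  have hfP : ∀ x, b < f (P x) := by
    classical
    refine fun x => hfb _ ⟨Pi.single x 1, single_mem_stdSimplex ℝ x, ?_⟩
    rw [Fintype.linearCombination_apply_single, one_smul]
  have hfX : f X < a := hfa X (Set.mem_Iic.2 le_rfl)
  have hpos : ∀ Z, 0 ≤ Z → 0 ≤ f Z := by
    intro Z hZ
    refine nonneg_of_forall_lt_add_mul (a := -a) (b := -f X) fun l hl => ?_
    have := hfa (X - l • Z) (sub_le_self X (smul_nonneg hl hZ))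
    simp only [map_sub, map_smul, smul_eq_mul] at this
    linarith
  -- Here `1 ≤ k` supplies a point of the polytope, without which `f` could vanish.
  have hne : f (P (⟨0, hk⟩, 1) - X) ≠ 0 := by
    rw [map_sub]
    exact (sub_pos.2 (hfX.trans (hab.trans (hfP _)))).ne'
  obtain ⟨s, m, hs0, hm, hsC, hs⟩ := exists_normalized hC f.toLinearMap hpos hne
  -- Because `oneNorm s = C`, the shift in `P` costs exactly `w i - v`; `m * (b - a)` is the slack
  -- of the strict separation.
  have hgap : ∀ i σ, w i - v + m * (b - a) ≤
      pairing s (permute σ (E.prospect (d i)) - X) := by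
    intro i σ
    have h1 : pairing s (P (i, σ)) = pairing s (permute σ (E.prospect (d i))) - (w i - v) := by
      rw [hP]
      simp only
      rw [pairing_sub, pairing_smul, ← oneNorm_eq_pairing_one hs0, hsC, div_mul_cancel₀ _ hC.ne']
    have h2 : m * (b - a) ≤ pairing s (P (i, σ)) - pairing s X := by
      rw [hs, hs, ← mul_sub]
      refine mul_le_mul_of_nonneg_left ?_ hm.le
      exact sub_le_sub (hfP _).le hfX.le
    rw [pairing_sub]
    linarith
  have hε : 0 < m * (b - a) := mul_pos hm (sub_pos.2 hab)
  -- The level `r` lies below `v` by less than the slack, so the kink stays above the listed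
  -- prospects, and above the finitely many values smaller than `v`, so it stays above the remaining
  -- ones.
  have hr : ∃ r < v, v - m * (b - a) < r ∧
      ∀ j, lawRCF C E (E.prospect j) < v → lawRCF C E (E.prospect j) < r := by
    have h1 : ∀ᶠ r in nhdsWithin v (Set.Iio v), v - m * (b - a) < r :=
      Filter.mem_of_superset (Ioo_mem_nhdsLT (sub_lt_self v hε)) fun r hr => hr.1
    have h2 : ∀ᶠ r in nhdsWithin v (Set.Iio v), ∀ j, lawRCF C E (E.prospect j) < v →
        lawRCF C E (E.prospect j) < r := by
      refine Filter.eventually_all.2 fun j => ?_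
      by_cases hj : lawRCF C E (E.prospect j) < v
      · exact Filter.mem_of_superset (Ioo_mem_nhdsLT hj) fun r hr _ => hr.1
      · exact Filter.Eventually.of_forall fun r h => absurd h hj
    obtain ⟨r, ⟨hr1, hr2⟩, hr3⟩ := ((h1.and h2).and self_mem_nhdsWithin).exists
    exact ⟨r, hr3, hr1, hr2⟩
  obtain ⟨r, hrv, hrε, hrj⟩ := hr
  refine (hrv.trans_le hX).not_ge (lawRCF_le_of_kink hT hC hs0 hsC.le fun j σ => ?_)
  rcases lt_or_ge (lawRCF C E (E.prospect j)) v with hj | hj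
  · exact (hrj j hj).le.trans (le_kink _ _ _ _)
  · obtain ⟨i, rfl⟩ := hd j hj
    have h1 := hgap i σ
    have h2 := le_max_left (pairing s (permute σ (E.prospect (d i)) - X)) 0
    rw [kink]
    simp only [hw] at h1
    linarith

/-! ### Size of the system -/

/-- A finite family of linear inequalities in two groups of variables has a matrix form. -/
lemma exists_matrix_form {ι V R : Type*} [Fintype ι] [DecidableEq ι] [AddCommGroup V] [Module ℝ V]
    [Fintype R] {m l : ℕ} (hR : Fintype.card R = m) (e : V ≃ₗ[ℝ] (Fin l → ℝ))
    (f : R → (ι → ℝ) →ₗ[ℝ] ℝ) (g : R → V →ₗ[ℝ] ℝ) (b : R → ℝ) :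
    ∃ (A : Matrix (Fin m) ι ℝ) (B : Matrix (Fin m) (Fin l) ℝ) (b' : Fin m → ℝ),
      ∀ x y, (∀ r, f r x + g r y ≤ b r) ↔ A.mulVec x + B.mulVec (e y) ≤ b' := by
  let ε := Fintype.equivFinOfCardEq hR
  refine ⟨(LinearMap.pi fun i => f (ε.symm i)).toMatrix',
    (LinearMap.pi fun i => g (ε.symm i) ∘ₗ e.symm.toLinearMap).toMatrix',
    fun i => b (ε.symm i), fun x y => ?_⟩
  rw [LinearMap.toMatrix'_mulVec, LinearMap.toMatrix'_mulVec, Pi.le_def, ← ε.symm.forall_congr_right]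
  simp

lemma exists_matrix_form_lawAcceptanceSystem (C v : ℝ) {k : ℕ} (θ : Fin k → Prospect T N)
    (w : Fin k → ℝ) :
    ∃ (e : ((Fin k → ℝ) × ℝ × (Fin k → Matrix (Fin T) (Fin T) ℝ)) ≃ₗ[ℝ]
          (Fin (k * (T ^ 2 + 1) + 1) → ℝ))
      (A : Matrix (Fin (T * N + k * (T ^ 2 + 4 * T + 1) + 4)) (Fin T × Fin N) ℝ)
      (B : Matrix (Fin (T * N + k * (T ^ 2 + 4 * T + 1) + 4)) (Fin (k * (T ^ 2 + 1) + 1)) ℝ)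
      (b : Fin (T * N + k * (T ^ 2 + 4 * T + 1) + 4) → ℝ),
      ∀ (X : Prospect T N) (p : Fin k → ℝ) (q : ℝ) (ρ : Fin k → Matrix (Fin T) (Fin T) ℝ),
        LawAcceptanceSystem C v θ w X p q ρ ↔
          A.mulVec (fun x => X x.1 x.2) + B.mulVec (e (p, q, ρ)) ≤ b := by
  have hfin : Module.finrank ℝ ((Fin k → ℝ) × ℝ × (Fin k → Matrix (Fin T) (Fin T) ℝ)) =
      Module.finrank ℝ (Fin (k * (T ^ 2 + 1) + 1) → ℝ) := by
    simp [Module.finrank_pi_fintype, Module.finrank_matrix]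
    ring
  let V := (Fin k → ℝ) × ℝ × (Fin k → Matrix (Fin T) (Fin T) ℝ)
  let π (i : Fin k) : V →ₗ[ℝ] ℝ := LinearMap.proj i ∘ₗ LinearMap.fst ℝ _ _
  let κ : V →ₗ[ℝ] ℝ := LinearMap.fst ℝ _ _ ∘ₗ LinearMap.snd ℝ _ _
  let μ (i : Fin k) (u t : Fin T) : V →ₗ[ℝ] ℝ :=
    Matrix.entryLinearMap ℝ ℝ u t ∘ₗ LinearMap.proj i ∘ₗ LinearMap.snd ℝ _ _ ∘ₗ LinearMap.snd ℝ _ _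
  -- Rows: domination, signs of `p` and `ρ`, column sums twice, row sums twice, level, total mass
  -- twice, sign of `q`.
  let R := (Fin T × Fin N) ⊕ (Fin k × Unit) ⊕ (Fin k × Fin T × Fin T) ⊕ (Fin k × Fin T) ⊕
    (Fin k × Fin T) ⊕ (Fin k × Fin T) ⊕ (Fin k × Fin T) ⊕ Unit ⊕ Unit ⊕ Unit ⊕ Unit
  have hR : Fintype.card R = T * N + k * (T ^ 2 + 4 * T + 1) + 4 := by
    simp [R]
    ring
  let f : R → (Fin T × Fin N → ℝ) →ₗ[ℝ] ℝ :=
    Sum.elim (fun x => -LinearMap.proj x) fun _ => 0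
  let g : R → V →ₗ[ℝ] ℝ :=
    Sum.elim (fun x => ∑ i, ∑ u, θ i u x.2 • μ i u x.1 - κ) <|
    Sum.elim (fun x => -π x.1) <|
    Sum.elim (fun x => -μ x.1 x.2.1 x.2.2) <|
    Sum.elim (fun x => ∑ u, μ x.1 u x.2 - π x.1) <|
    Sum.elim (fun x => π x.1 - ∑ u, μ x.1 u x.2) <|
    Sum.elim (fun x => ∑ u, μ x.1 x.2 u - π x.1) <|
    Sum.elim (fun x => π x.1 - ∑ u, μ x.1 x.2 u) <|
    Sum.elim (fun _ => C • κ - ∑ i, w i • π i) <|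
    Sum.elim (fun _ => ∑ i, π i) <|
    Sum.elim (fun _ => -∑ i, π i) fun _ => -κ
  let b : R → ℝ :=
    Sum.elim (fun _ => 0) <| Sum.elim (fun _ => 0) <| Sum.elim (fun _ => 0) <|
    Sum.elim (fun _ => 0) <| Sum.elim (fun _ => 0) <| Sum.elim (fun _ => 0) <|
    Sum.elim (fun _ => 0) <|
    Sum.elim (fun _ => -v) <| Sum.elim (fun _ => 1) <| Sum.elim (fun _ => -1) fun _ => 0
  obtain ⟨A, B, b', h⟩ := exists_matrix_form hR (LinearEquiv.ofFinrankEq _ _ hfin) f g b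
  refine ⟨LinearEquiv.ofFinrankEq _ _ hfin, A, B, b', fun X p q ρ => ?_⟩
  rw [← h]
  have hdom : ∀ t n, ∑ i, ((ρ i)ᵀ *ᵥ fun u => θ i u n) t =
      ∑ i, ∑ u, θ i u n * ρ i u t := fun t n =>
    Finset.sum_congr rfl fun i _ => by
      simp [Matrix.mulVec, dotProduct, mul_comm]
  simp only [R, f, g, b, π, κ, μ, Sum.forall, Sum.elim_inl, Sum.elim_inr, LinearMap.sub_apply,
    LinearMap.neg_apply, LinearMap.zero_apply, LinearMap.smul_apply, LinearMap.sum_apply,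
    LinearMap.coe_comp, Function.comp_apply, LinearMap.proj_apply, LinearMap.fst_apply,
    LinearMap.snd_apply, Matrix.entryLinearMap_apply, smul_eq_mul, zero_add, Prod.forall, forall_const]
  constructor
  · intro H
    refine ⟨fun t n => ?_, fun i => ?_, fun i t u => ?_, fun i t => ?_, fun i t => ?_,
      fun i t => ?_, fun i t => ?_, ?_, ?_, ?_, ?_⟩
    · have := H.domination n t
      rw [hdom] at this
      linarith
    · linarith [H.p_nonneg i]
    · linarith [H.ρ_nonneg i t u]
    · linarith [H.column_sum i t]
    · linarith [H.column_sum i t]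
    · linarith [H.row_sum i t]
    · linarith [H.row_sum i t]
    · linarith [H.level]
    · linarith [H.sum_p]
    · linarith [H.sum_p]
    · linarith [H.q_nonneg]
  · rintro ⟨h1, h2, h3, h4, h5, h6, h7, h8, h9, h10, h11⟩
    refine ⟨by linarith, fun n t => ?_, by linarith, fun i => by linarith [h2 i], by linarith,
      fun i t => by linarith [h4 i t, h5 i t], fun i t => by linarith [h6 i t, h7 i t],
      fun i t u => by linarith [h3 i t u]⟩
    rw [hdom]
    linarith [h1 t n]

end RobustChoice

end

theorem mainTheorem9 (T N K : ℕ) (hT : 1 ≤ T) (hN : 1 ≤ N) (C : ℝ) (hC : 0 < C)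
    (E : RobustChoice.ElicitationData T N K) :
    -- an optimal solution of the value problem, and a decomposition along it, exist
    (∃ (vs : RobustChoice.Prospect T N → ℝ)
        (s : RobustChoice.Prospect T N → RobustChoice.Prospect T N)
        (d : Fin (2 * K + 1) ≃ RobustChoice.ProspectIndex K),
      RobustChoice.IsValueOptimal C E vs s ∧ RobustChoice.IsDecomposition E vs d) ∧
    ∀ (vs : RobustChoice.Prospect T N → ℝ)
      (s : RobustChoice.Prospect T N → RobustChoice.Prospect T N),
      RobustChoice.IsValueOptimal C E vs s →
      -- the optimal values are those of the robust choice function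
      (∀ i : RobustChoice.ProspectIndex K,
        vs (E.prospect i) = RobustChoice.lawRCF C E (E.prospect i)) ∧
      ∀ d : Fin (2 * K + 1) ≃ RobustChoice.ProspectIndex K,
        RobustChoice.IsDecomposition E vs d →
      ∀ v : ℝ, v ≤ 0 →
        ∃ (k : ℕ) (hk : k ≤ 2 * K + 1),
          RobustChoice.levelSelection (fun i => vs (E.prospect (d i))) v = {k} ∧
          RobustChoice.lawAcceptanceSet C E v =
            {X | ∃ (p : Fin k → ℝ) (q : ℝ) (ρ : Fin k → Matrix (Fin T) (Fin T) ℝ),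
              RobustChoice.LawAcceptanceSystem C v
                (fun i => E.prospect (d (Fin.castLE hk i)))
                (fun i => vs (E.prospect (d (Fin.castLE hk i)))) X p q ρ} ∧
          -- the system consists of `T N + k (T² + 4 T + 1) + 4` linear inequalities
          -- in `X` and `k (T² + 1) + 1` auxiliary real variables
          ∃ (e : ((Fin k → ℝ) × ℝ × (Fin k → Matrix (Fin T) (Fin T) ℝ)) ≃ₗ[ℝ]
                (Fin (k * (T ^ 2 + 1) + 1) → ℝ))
            (A : Matrix (Fin (T * N + k * (T ^ 2 + 4 * T + 1) + 4)) (Fin T × Fin N) ℝ)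
            (B : Matrix (Fin (T * N + k * (T ^ 2 + 4 * T + 1) + 4))
              (Fin (k * (T ^ 2 + 1) + 1)) ℝ)
            (b : Fin (T * N + k * (T ^ 2 + 4 * T + 1) + 4) → ℝ),
            ∀ (X : RobustChoice.Prospect T N) (p : Fin k → ℝ) (q : ℝ)
              (ρ : Fin k → Matrix (Fin T) (Fin T) ℝ),
              RobustChoice.LawAcceptanceSystem C v
                (fun i => E.prospect (d (Fin.castLE hk i)))
                (fun i => vs (E.prospect (d (Fin.castLE hk i)))) X p q ρ ↔
              A.mulVec (fun x => X x.1 x.2) + B.mulVec (e (p, q, ρ)) ≤ b := by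
  have hval : ∀ {vs s}, RobustChoice.IsValueOptimal C E vs s →
      ∀ i, vs (E.prospect i) = RobustChoice.lawRCF C E (E.prospect i) := fun h i =>
    h.eq_lawRCF hT hC (RobustChoice.prospect_mem_lawSupport E i)
  constructor
  · obtain ⟨s, hs⟩ := RobustChoice.exists_isValueOptimal_lawRCF hT hC E
    obtain ⟨d, hd⟩ := RobustChoice.exists_isDecomposition E (RobustChoice.lawRCF C E)
    exact ⟨_, s, d, hs, hd⟩
  refine fun vs s hvs => ⟨hval hvs, fun d hd v hv => ?_⟩
  -- Since `ψ(W₀) = 0 ≥ v`, at least one prospect reaches the level `v`.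
  obtain ⟨k, hk1, hkJ, hsel, hiff⟩ := RobustChoice.exists_levelSelection_eq hd (v := v) <| by
    refine ⟨d.symm none, ?_⟩
    rw [Equiv.apply_symm_apply, hval hvs]
    exact hv.trans_eq (RobustChoice.isLawAdmissible_lawRCF hT hC E).nor.symm
  refine ⟨k, hkJ, hsel, ?_, RobustChoice.exists_matrix_form_lawAcceptanceSystem _ _ _ _⟩
  simp only [hval hvs] at hiff ⊢
  ext X
  constructor
  · refine RobustChoice.exists_lawAcceptanceSystem hT hC hk1 (fun i => (hiff _).2 i.2)
      fun j hj => ?_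
    rw [← d.apply_symm_apply j, hiff] at hj
    exact ⟨⟨_, hj⟩, d.apply_symm_apply j⟩
  · rintro ⟨p, q, ρ, h⟩
    exact h.le_lawRCF hT hC fun i => (hiff _).2 i.2
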